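/- **Setup.** Let $\{G_i\}_{i\in I}$ be a family of finitely generated groups with a finite generating set $S_i\subseteq G_i$ for each $i\in I$. Let $\ell_{S_i}(g)$ be the least $k$ such that $g$ is a product of $k$ elements of $S_i\cup S_i^{-1}$, equip $G_i$ with the word length metric $d_i(g,h)=\ell_{S_i}(g^{-1}h)$, and let $B(x,D)$ denote the closed ball of radius $D$ around $x$. Assume that each $G_i$ is amenable, i.e. for all $R,\varepsilon>0$ there is a non-empty finite set $F\subseteq G_i$ with $\sharp\,\partial_R F\le\varepsilon\,\sharp F$, where $\partial_RF=\{x\in G_i\setminus F: d_i(x,F)\le R\}$. For a set $X$, let $\ell^2(X)_{1,+}$ be the set of functions $f\in\ell^2(X)$ with $\|f\|_2=1$ and $f(x)\ge 0$ for all $x\in X$. For a function $f$ on a group $G$ and $\gamma\in G$, put $(\gamma\cdot f)(h)=f(h\gamma)$ and $(\gamma\star f)(h)=f(\gamma^{-1}h)$. For $f\in\ell^1(G)\cap\ell^2(G)_{1,+}$, let $T_f$ be the bounded linear operator on $\ell^2(G)$ which on finitely supported functions $h$ is given by $$(T_fh)(\gamma)=\sum_{\gamma'\in G}\langle\gamma\star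 f,\gamma'\star f\rangle_{\ell^2(G)}\,h(\gamma').$$ **Theorem 3.7.** Consider the following conditions: 1. For any $\varepsilon>0$ there exist $M>0$ and a family $\{f_i\}_{i\in I}$ with $f_i\in\ell^2(G_i)_{1,+}\cap\ell^1(G_i)$ such that, for all $i\in I$, $\|f_i-s\cdot f_i\|_2\le\varepsilon$ for all $s\in S_i$, and $\|f_i\|_1\le M$. 2. For any $\varepsilon>0$ there exist $M'>0$ and a family $\{f_i\}_{i\in I}$ with $f_i\in\ell^2(G_i)_{1,+}\cap\ell^1(G_i)$ such that, for all $i\in I$, $\|f_i-s\cdot f_i\|_2\le\varepsilon$ for all $s\in S_i$, and the operator norm of $T_{f_i}$ is at most $M'$. 3. For any $\varepsilon>0$ there exist $N>0$ and a family $\{f_i\}_{i\in I}$ with $f_i\in\ell^2(G_i)_{1,+}$ such that, for all $i\in I$, $\|f_i-s\cdot f_i\|_2\le\varepsilon$ for all $s\in S_i$, and $\sharp\,\mathrm{supp}(f_i)\le N$. 4. $\{(G_i,S_i)\}_{i\in I}$ is uniformly amenable: for any $\varepsilon>0$ there exist $D>0$ and a family $\{f_i\}_{i\in I}$ with $f_i\in\ell^2(G_i)_{1,+}$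 such that, for all $i\in I$, $\|f_i-s\cdot f_i\|_2\le\varepsilon$ for all $s\in S_i$, and $\mathrm{supp}(f_i)\subseteq B(1_{G_i},D)$. 5. $\{(G_i,S_i)\}_{i\in I}$ has uniform Property A: for any $\varepsilon>0$ and $R>0$ there exist $D>0$ and a family of maps $\xi_i:G_i\to\ell^2(G_i)_{1,+}$ such that, for all $i\in I$, $\|\xi_i(x)-\xi_i(y)\|_2\le\varepsilon$ whenever $d_i(x,y)\le R$, and $\mathrm{supp}(\xi_i(x))\subseteq B(x,D)$ for all $x\in G_i$. Then (1) $\Leftrightarrow$ (2) $\Rightarrow$ (3) $\Rightarrow$ (4) $\Leftrightarrow$ (5). If, in addition, there exists $L>0$ such that $\sharp S_i\le L$ for all $i\in I$, then all five conditions are equivalent. -/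

import Mathlib

open scoped ComplexOrder ENNReal

noncomputable section

namespace UniformAmenability

/-! ### Word length metrics -/

/-- The word length of `g` with respect to `S`: the least `k` such that `g` is a product of `k`
elements, each of which lies in `S` or is the inverse of an element of `S`. -/
def wordLength {G : Type*} [Group G] (S : Finset G) (g : G) : ℕ :=
  sInf {k : ℕ | ∃ l : List G, (∀ x ∈ l, x ∈ S ∨ x⁻¹ ∈ S) ∧ l.length = k ∧ l.prod = g}

/-- The left-invariant word length distance `d_S(g, h) = ℓ_S(g⁻¹ h)`. -/
def wordDist {G : Type*} [Group G] (S : Finset G) (g h : G) : ℝ :=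
  (wordLength S (g⁻¹ * h) : ℝ)

lemma wordLength_le {G : Type*} [Group G] (S : Finset G) (l : List G)
    (hl : ∀ x ∈ l, x ∈ S ∨ x⁻¹ ∈ S) : wordLength S l.prod ≤ l.length :=
  Nat.sInf_le ⟨l, hl, rfl, rfl⟩

lemma exists_word {G : Type*} [Group G] {S : Finset G}
    (hS : Subgroup.closure (S : Set G) = ⊤) (g : G) :
    ∃ l : List G, (∀ x ∈ l, x ∈ S ∨ x⁻¹ ∈ S) ∧ l.length = wordLength S g ∧ l.prod = g := by
  have hg : g ∈ Subgroup.closure (S : Set G) := by rw [hS]; trivial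
  rw [← Subgroup.mem_toSubmonoid, Subgroup.closure_toSubmonoid] at hg
  obtain ⟨l, hl, hp⟩ := Submonoid.exists_list_of_mem_closure hg
  exact Nat.sInf_mem
    (s := {k : ℕ | ∃ l : List G, (∀ x ∈ l, x ∈ S ∨ x⁻¹ ∈ S) ∧ l.length = k ∧ l.prod = g})
    ⟨l.length, l, fun x hx => by simpa using hl x hx, rfl, hp⟩

lemma wordLength_one {G : Type*} [Group G] (S : Finset G) : wordLength S (1 : G) = 0 := by
  simpa using wordLength_le S ([] : List G) (by simp)

lemma eq_one_of_wordLength {G : Type*} [Group G] {S : Finset G}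
    (hS : Subgroup.closure (S : Set G) = ⊤) {g : G} (h : wordLength S g = 0) : g = 1 := by
  obtain ⟨l, -, hlen, hp⟩ := exists_word hS g
  rw [h, List.length_eq_zero_iff] at hlen
  subst hlen
  simpa using hp.symm

lemma wordLength_mul_le {G : Type*} [Group G] {S : Finset G}
    (hS : Subgroup.closure (S : Set G) = ⊤) (g h : G) :
    wordLength S (g * h) ≤ wordLength S g + wordLength S h := by
  obtain ⟨l, hl, hlen, hp⟩ := exists_word hS g
  obtain ⟨l', hl', hlen', hp'⟩ := exists_word hS h
  have := wordLength_le S (l ++ l') (by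
    intro x hx
    rcases List.mem_append.1 hx with hx | hx
    · exact hl x hx
    · exact hl' x hx)
  rw [List.prod_append, hp, hp', List.length_append, hlen, hlen'] at this
  exact this

lemma wordLength_inv_le {G : Type*} [Group G] {S : Finset G}
    (hS : Subgroup.closure (S : Set G) = ⊤) (g : G) :
    wordLength S g⁻¹ ≤ wordLength S g := by
  obtain ⟨l, hl, hlen, hp⟩ := exists_word hS g
  have := wordLength_le S (l.map (fun x => x⁻¹)).reverse (by
    intro x hx
    rw [List.mem_reverse, List.mem_map] at hx
    obtain ⟨y, hy, rfl⟩ := hx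
    rw [inv_inv]
    exact (hl y hy).symm)
  rw [← List.prod_inv_reverse, hp, List.length_reverse, List.length_map, hlen] at this
  exact this

/-- The word length metric on `G` associated to a finite generating set `S`. -/
@[reducible]
def wordMetricSpace {G : Type*} [Group G] (S : Finset G)
    (hS : Subgroup.closure (S : Set G) = ⊤) : MetricSpace G where
  dist := wordDist S
  dist_self x := by simp [wordDist, wordLength_one]
  dist_comm x y := by
    have key : ∀ a b : G, wordDist S a b ≤ wordDist S b a := fun a b => by
      have := wordLength_inv_le hS (b⁻¹ * a)
      rw [mul_inv_rev, inv_inv] at this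
      exact Nat.cast_le.2 this
    exact le_antisymm (key x y) (key y x)
  dist_triangle x y z := by
    have := wordLength_mul_le hS (x⁻¹ * y) (y⁻¹ * z)
    rw [mul_assoc, mul_inv_cancel_left] at this
    simp only [wordDist]
    exact_mod_cast this
  eq_of_dist_eq_zero {x y} h := by
    have h' : wordLength S (x⁻¹ * y) = 0 := Nat.cast_eq_zero.1 (show wordDist S x y = 0 from h)
    exact inv_mul_eq_one.1 (eq_one_of_wordLength hS h')

/-! ### Amenability -/

/-- The `R`-boundary `{x ∈ X \ A : d(x, A) ≤ R}` of `A`. -/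
def boundary {X : Type*} [MetricSpace X] (R : ℝ) (A : Set X) : Set X :=
  {x | x ∉ A ∧ Metric.infDist x A ≤ R}

/-- Amenability by the Følner condition: for all `R, ε > 0` there is a non-empty finite set `F`
with `#∂_R F / #F ≤ ε`. It is used for finitely generated groups with a word length metric. -/
def IsAmenable (X : Type*) [MetricSpace X] : Prop :=
  ∀ R > (0 : ℝ), ∀ ε > (0 : ℝ), ∃ F : Finset X, F.Nonempty ∧
    (boundary R (F : Set X)).Finite ∧
    ((boundary R (F : Set X)).ncard : ℝ) / (F.card : ℝ) ≤ ε

/-! ### The spaces `ℓ²(X)` and translations -/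

/-- The complex Hilbert space `ℓ²(X)`. -/
abbrev Ell2 (X : Type*) : Type _ := lp (fun _ : X => ℂ) 2

/-- `ℓ²(X)_{1,+}`: the non-negative (in particular real-valued) functions in `ℓ²(X)` of
norm one. -/
def Ell2UnitPos (X : Type*) : Set (Ell2 X) :=
  {f | ‖f‖ = 1 ∧ ∀ x, 0 ≤ f x}

/-- Composition of an element of `ℓ²(X)` with a permutation of `X`. -/
def compPerm {X : Type*} (e : Equiv.Perm X) (f : Ell2 X) : Ell2 X :=
  ⟨fun x => f (e x), by
    have hf := (lp.memℓp f).summable (by norm_num)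
    exact memℓp_gen ((e.summable_iff (f := fun x => ‖f x‖ ^ (2 : ℝ≥0∞).toReal)).2 hf)⟩

/-- The right translation `(γ · f)(h) = f (h γ)`. -/
def rightTranslate {G : Type*} [Group G] (γ : G) (f : Ell2 G) : Ell2 G :=
  compPerm (Equiv.mulRight γ) f

/-- The left translation `(γ ⋆ f)(h) = f (γ⁻¹ h)`. -/
def leftTranslate {G : Type*} [Group G] (γ : G) (f : Ell2 G) : Ell2 G :=
  compPerm (Equiv.mulLeft γ⁻¹) f

lemma rightTranslate_apply {G : Type*} [Group G] (γ : G) (f : Ell2 G) (h : G) :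
    rightTranslate γ f h = f (h * γ) := rfl

lemma leftTranslate_apply {G : Type*} [Group G] (γ : G) (f : Ell2 G) (h : G) :
    leftTranslate γ f h = f (γ⁻¹ * h) := rfl

/-! ### The operator associated to a function -/

/-- The kernel `K_f(x, y) = ⟨x ⋆ f, y ⋆ f⟩`, where `⟨a, b⟩ = ∑ z, a z * conj (b z)` (Mathlib's
inner product is conjugate-linear in the first variable, whence the order). -/
def assocKernel {G : Type*} [Group G] (f : Ell2 G) (x y : G) : ℂ :=
  inner ℂ (leftTranslate y f) (leftTranslate x f)

/-- The formal multiplication `(T_K h)(γ) = ∑ γ', K(γ, γ') h(γ')` of a kernel with a finitely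
supported function. -/
def kernelApply {G : Type*} (K : G → G → ℂ) (h : G →₀ ℂ) (γ : G) : ℂ :=
  ∑ γ' ∈ h.support, K γ γ' * h γ'

/-- `T` is the operator associated to `f`: the bounded operator on `ℓ²(G)` that extends
`h ↦ T_{K_f} h` from the dense subspace of finitely supported functions. -/
def IsAssocOperator {G : Type*} [Group G] (f : Ell2 G) (T : Ell2 G →L[ℂ] Ell2 G) : Prop :=
  ∀ (h : G →₀ ℂ) (α : Ell2 G), (∀ x, α x = h x) → ∀ γ, T α γ = kernelApply (assocKernel f) h γ

/-- The operator associated to `f` is unique. -/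
lemma IsAssocOperator.unique {G : Type*} [Group G] {f : Ell2 G} {T T' : Ell2 G →L[ℂ] Ell2 G}
    (hT : IsAssocOperator f T) (hT' : IsAssocOperator f T') : T = T' := by
  classical
  have hs : ∀ (x : G) (c : ℂ), T (lp.single 2 x c) = T' (lp.single 2 x c) := fun x c => by
    have hx : ∀ y, lp.single (E := fun _ : G => ℂ) 2 x c y = Finsupp.single x c y := fun y => by
      rw [lp.single_apply, Finsupp.single_eq_pi_single]
    ext γ
    rw [hT _ _ hx, hT' _ _ hx]
  ext1 α
  have h := lp.hasSum_single (E := fun _ : G => ℂ) (p := 2) (by norm_num) α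
  have h1 := h.mapL T
  have h2 := h.mapL T'
  simp only [hs] at h1
  exact h1.unique h2

/-! ### The conditions on a family of groups -/

/-- For every `ε > 0` there are `M > 0` and `f i ∈ ℓ²(G i)_{1,+} ∩ ℓ¹(G i)` with
`‖f i - s · f i‖₂ ≤ ε` for `s ∈ S i` and `‖f i‖₁ ≤ M`. -/
def BoundedEll1Norm {I : Type*} {G : I → Type*} [∀ i, Group (G i)]
    (S : ∀ i, Finset (G i)) : Prop :=
  ∀ ε > (0 : ℝ), ∃ M > (0 : ℝ), ∃ f : ∀ i, Ell2 (G i), ∀ i,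
    f i ∈ Ell2UnitPos (G i) ∧ Memℓp (fun γ => f i γ) 1 ∧
    (∀ s ∈ S i, ‖f i - rightTranslate s (f i)‖ ≤ ε) ∧
    ∑' γ, ‖f i γ‖ ≤ M

/-- For every `ε > 0` there are `M' > 0` and `f i ∈ ℓ²(G i)_{1,+} ∩ ℓ¹(G i)` with
`‖f i - s · f i‖₂ ≤ ε` for `s ∈ S i` such that the operator norm of the operator associated to
`f i` is at most `M'`. -/
def BoundedOperatorNorm {I : Type*} {G : I → Type*} [∀ i, Group (G i)]
    (S : ∀ i, Finset (G i)) : Prop :=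
  ∀ ε > (0 : ℝ), ∃ M' > (0 : ℝ), ∃ f : ∀ i, Ell2 (G i), ∀ i,
    f i ∈ Ell2UnitPos (G i) ∧ Memℓp (fun γ => f i γ) 1 ∧
    (∀ s ∈ S i, ‖f i - rightTranslate s (f i)‖ ≤ ε) ∧
    ∃ T : Ell2 (G i) →L[ℂ] Ell2 (G i), IsAssocOperator (f i) T ∧ ‖T‖ ≤ M'

/-- For every `ε > 0` there are `N > 0` and `f i ∈ ℓ²(G i)_{1,+}` with
`‖f i - s · f i‖₂ ≤ ε` for `s ∈ S i` whose supports have at most `N` elements. -/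
def BoundedSupportCard {I : Type*} {G : I → Type*} [∀ i, Group (G i)]
    (S : ∀ i, Finset (G i)) : Prop :=
  ∀ ε > (0 : ℝ), ∃ N : ℕ, 0 < N ∧ ∃ f : ∀ i, Ell2 (G i), ∀ i,
    f i ∈ Ell2UnitPos (G i) ∧
    (∀ s ∈ S i, ‖f i - rightTranslate s (f i)‖ ≤ ε) ∧
    (Function.support fun γ => f i γ).encard ≤ (N : ℕ∞)

/-- Uniform amenability: for every `ε > 0` there are `D > 0` and `f i ∈ ℓ²(G i)_{1,+}` with
`‖f i - s · f i‖₂ ≤ ε` for `s ∈ S i` and `supp (f i) ⊆ B(1, D)`. -/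
def UniformlyAmenable {I : Type*} {G : I → Type*} [∀ i, Group (G i)]
    (S : ∀ i, Finset (G i)) : Prop :=
  ∀ ε > (0 : ℝ), ∃ D > (0 : ℝ), ∃ f : ∀ i, Ell2 (G i), ∀ i,
    f i ∈ Ell2UnitPos (G i) ∧
    (∀ s ∈ S i, ‖f i - rightTranslate s (f i)‖ ≤ ε) ∧
    (Function.support fun γ => f i γ) ⊆ {γ | wordDist (S i) 1 γ ≤ D}

/-- `f` has `(ε, R)`-variation. -/
def HasVariation {X Y : Type*} [MetricSpace X] [MetricSpace Y] (ε R : ℝ) (f : X → Y) : Prop :=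
  ∀ x y, dist x y ≤ R → dist (f x) (f y) ≤ ε

/-- Uniform Property A of a family of metric spaces. -/
def UniformPropertyA {I : Type*} (X : I → Type*) [∀ i, MetricSpace (X i)] : Prop :=
  ∀ ε > (0 : ℝ), ∀ R > (0 : ℝ), ∃ D > (0 : ℝ), ∃ ξ : ∀ i, X i → Ell2 (X i), ∀ i,
    (∀ x, ξ i x ∈ Ell2UnitPos (X i)) ∧
    HasVariation ε R (ξ i) ∧
    ∀ x, (Function.support fun y => ξ i x y) ⊆ Metric.closedBall x D

end UniformAmenability

end

noncomputable section

namespace UniformAmenability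

/-! ### Norms in `ℓ²` -/

/-! Conditions 1 and 3 are equivalent without amenability. Cutting an `ℓ¹`-bounded function off at a
small height loses little `ℓ²` mass and leaves boundedly many points; conversely a unit vector has
entries at most 1, so its `ℓ¹` norm is at most the size of its support.

Conditions 1 and 2 are linked by `T_f = C* C`, where `C` sends `δ_γ` to `γ ⋆ f`. It has norm at most
`‖f‖₁`, so `‖T_f‖ ≤ ‖f‖₁²`. Amenability gives `‖f‖₁² ≤ 2 ‖T_f‖`: test `T_f` on the indicator of a
thickened Følner set (`sq_sum_norm_le`).

The remaining two constructions share one device, `exists_unitPos_average`. Left translations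
commute with right ones, so pieces of functions can be moved to the identity without changing their
variation; the pointwise Euclidean norm of the moved pieces adds squared norms and does not increase
the sum of squared variations. For 3 to 4 the pieces are the restrictions of `f` to the connected
components of its support. For 5 to 4 they are the columns `x ↦ ξ x y`, with `y` near a Følner set.

From 4 to 5 one takes `ξ x y = f (y⁻¹ x)`. A bound on `#S i` bounds the size of balls, which returns
from 4 to 3. -/

lemma hasSum_normSq {X : Type*} (f : Ell2 X) : HasSum (fun x => ‖f x‖ ^ 2) (‖f‖ ^ 2) := by
  have h := lp.hasSum_norm (p := 2) (by norm_num) f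
  simpa using h

lemma memℓp_two_of_summable {X : Type*} {u : X → ℂ} (h : Summable fun x => ‖u x‖ ^ 2) :
    Memℓp u 2 :=
  memℓp_gen (by simpa using h)

lemma memℓp_two_of_finite {X : Type*} {u : X → ℂ} (h : (Function.support u).Finite) :
    Memℓp u 2 :=
  memℓp_two_of_summable <| summable_of_hasFiniteSupport <| h.subset fun x hx => by
    rw [Function.mem_support] at hx ⊢
    contrapose! hx
    simp [hx]

lemma norm_compPerm {X : Type*} (e : Equiv.Perm X) (f : Ell2 X) : ‖compPerm e f‖ = ‖f‖ := by
  have h1 := hasSum_normSq (compPerm e f)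
  have h2 : HasSum (fun x => ‖f (e x)‖ ^ 2) (‖f‖ ^ 2) :=
    (e.hasSum_iff (f := fun x => ‖f x‖ ^ 2)).2 (hasSum_normSq f)
  exact (sq_eq_sq₀ (norm_nonneg _) (norm_nonneg _)).1 (h1.unique h2)

/-- Composition with a permutation as a linear isometry. -/
def compPermₗᵢ {X : Type*} (e : Equiv.Perm X) : Ell2 X →ₗᵢ[ℂ] Ell2 X where
  toFun := compPerm e
  map_add' _ _ := rfl
  map_smul' _ _ := rfl
  norm_map' := norm_compPerm e

lemma leftTranslate_sub {G : Type*} [Group G] (γ : G) (f g : Ell2 G) :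
    leftTranslate γ (f - g) = leftTranslate γ f - leftTranslate γ g := rfl

lemma rightTranslate_sub {G : Type*} [Group G] (γ : G) (f g : Ell2 G) :
    rightTranslate γ (f - g) = rightTranslate γ f - rightTranslate γ g := rfl

lemma norm_leftTranslate {G : Type*} [Group G] (γ : G) (f : Ell2 G) :
    ‖leftTranslate γ f‖ = ‖f‖ := norm_compPerm _ f

lemma norm_rightTranslate {G : Type*} [Group G] (γ : G) (f : Ell2 G) :
    ‖rightTranslate γ f‖ = ‖f‖ := norm_compPerm _ f

lemma leftTranslate_rightTranslate {G : Type*} [Group G] (γ s : G) (f : Ell2 G) :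
    leftTranslate γ (rightTranslate s f) = rightTranslate s (leftTranslate γ f) := by
  ext h
  simp only [leftTranslate_apply, rightTranslate_apply, mul_assoc]

lemma coe_norm_of_unitPos {X : Type*} {f : Ell2 X} (hf : f ∈ Ell2UnitPos X) (x : X) :
    ((‖f x‖ : ℝ) : ℂ) = f x := by
  simpa using (RCLike.norm_of_nonneg' (hf.2 x))

lemma norm_le_one_of_unitPos {X : Type*} {f : Ell2 X} (hf : f ∈ Ell2UnitPos X) (x : X) :
    ‖f x‖ ≤ 1 := hf.1 ▸ lp.norm_apply_le_norm (by norm_num) f x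

/-! ### Averaging -/

/-- The pointwise Euclidean norm of a finite family in `ℓ²`. -/
def pointwiseNorm {X ι : Type*} (J : Finset ι) (v : ι → Ell2 X) : Ell2 X :=
  ⟨fun x => (√(∑ j ∈ J, ‖v j x‖ ^ 2) : ℝ), by
    refine memℓp_two_of_summable ?_
    refine (hasSum_sum fun j (_ : j ∈ J) => hasSum_normSq (v j)).summable.congr fun x => ?_
    rw [Complex.norm_real, Real.norm_eq_abs, sq_abs, Real.sq_sqrt (by positivity)]⟩

lemma pointwiseNorm_apply {X ι : Type*} (J : Finset ι) (v : ι → Ell2 X) (x : X) :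
    pointwiseNorm J v x = (√(∑ j ∈ J, ‖v j x‖ ^ 2) : ℝ) := rfl

lemma norm_pointwiseNorm_sq {X ι : Type*} (J : Finset ι) (v : ι → Ell2 X) :
    ‖pointwiseNorm J v‖ ^ 2 = ∑ j ∈ J, ‖v j‖ ^ 2 := by
  refine (hasSum_normSq _).unique ?_
  refine (hasSum_sum fun j (_ : j ∈ J) => hasSum_normSq (v j)).congr_fun ?_
  intro x
  rw [pointwiseNorm_apply, Complex.norm_real, Real.norm_eq_abs, sq_abs,
    Real.sq_sqrt (by positivity)]

/-- The reverse triangle inequality in the Euclidean space over `J`. -/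
lemma sqrt_sum_sub_sq_le {ι : Type*} (J : Finset ι) (a b : ι → ℂ) :
    (√(∑ j ∈ J, ‖a j‖ ^ 2) - √(∑ j ∈ J, ‖b j‖ ^ 2)) ^ 2 ≤ ∑ j ∈ J, ‖a j - b j‖ ^ 2 := by
  have key : ∀ c : ι → ℂ, √(∑ j ∈ J, ‖c j‖ ^ 2) =
      ‖(WithLp.toLp 2 (fun j : J => c j) : EuclideanSpace ℂ J)‖ := fun c => by
    rw [EuclideanSpace.norm_eq, ← Finset.sum_coe_sort J]
  have h := abs_norm_sub_norm_le (WithLp.toLp 2 (fun j : J => a j) : EuclideanSpace ℂ J)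
    (WithLp.toLp 2 (fun j : J => b j))
  rw [← WithLp.toLp_sub] at h
  have h2 := key (fun j => a j - b j)
  rw [key a, key b, ← Real.sq_sqrt (by positivity : 0 ≤ ∑ j ∈ J, ‖a j - b j‖ ^ 2), h2,
    ← sq_abs]
  exact pow_le_pow_left₀ (abs_nonneg _) h 2

lemma norm_pointwiseNorm_sub_sq_le {G ι : Type*} [Group G] (J : Finset ι) (v : ι → Ell2 G)
    (s : G) : ‖pointwiseNorm J v - rightTranslate s (pointwiseNorm J v)‖ ^ 2 ≤
      ∑ j ∈ J, ‖v j - rightTranslate s (v j)‖ ^ 2 := by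
  refine hasSum_le (fun x => ?_) (hasSum_normSq _)
    (hasSum_sum fun j (_ : j ∈ J) => hasSum_normSq (v j - rightTranslate s (v j)))
  have := sqrt_sum_sub_sq_le J (fun j => v j x) (fun j => v j (x * s))
  rw [lp.coeFn_sub, Pi.sub_apply, rightTranslate_apply, pointwiseNorm_apply, pointwiseNorm_apply,
    ← Complex.ofReal_sub, Complex.norm_real, Real.norm_eq_abs, sq_abs]
  exact this

/-- Averaging a finite family of functions in `ℓ²(G)` after moving them by left translations. -/
lemma exists_unitPos_average {G : Type*} [Group G] (J : Finset G) (w : G → Ell2 G)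
    (hw : 0 < ∑ c ∈ J, ‖w c‖ ^ 2) :
    ∃ f ∈ Ell2UnitPos G, (∀ k, f k ≠ 0 → ∃ c ∈ J, w c (c * k) ≠ 0) ∧
      ∀ s, ‖f - rightTranslate s f‖ ^ 2 * ∑ c ∈ J, ‖w c‖ ^ 2 ≤
        ∑ c ∈ J, ‖w c - rightTranslate s (w c)‖ ^ 2 := by
  -- Translation by `c⁻¹` carries a piece supported near `c` to one supported near the identity.
  set v : G → Ell2 G := fun c => leftTranslate c⁻¹ (w c) with hv
  set F := pointwiseNorm J v with hF
  have hn : ‖F‖ ^ 2 = ∑ c ∈ J, ‖w c‖ ^ 2 := by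
    rw [hF, norm_pointwiseNorm_sq]
    simp only [hv, norm_leftTranslate]
  have hpos : 0 < ‖F‖ := by
    rw [← hn] at hw
    exact lt_of_le_of_ne (norm_nonneg _) fun h => by simp [← h] at hw
  refine ⟨((‖F‖⁻¹ : ℝ) : ℂ) • F, ⟨?_, fun x => ?_⟩, fun k hk => ?_, fun s => ?_⟩
  · rw [norm_smul, Complex.norm_real, norm_inv, norm_norm, inv_mul_cancel₀ hpos.ne']
  · rw [lp.coeFn_smul, Pi.smul_apply, smul_eq_mul, hF, pointwiseNorm_apply, ← Complex.ofReal_mul]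
    exact Complex.zero_le_real.2 (by positivity)
  · by_contra! h
    apply hk
    rw [lp.coeFn_smul, Pi.smul_apply, hF, pointwiseNorm_apply, Finset.sum_eq_zero]
    · simp
    · intro c hc
      rw [hv, leftTranslate_apply, inv_inv, h c hc]
      simp
  · have h1 : ((‖F‖⁻¹ : ℝ) : ℂ) • F - rightTranslate s (((‖F‖⁻¹ : ℝ) : ℂ) • F) =
        ((‖F‖⁻¹ : ℝ) : ℂ) • (F - rightTranslate s F) := by
      rw [smul_sub]; rfl
    rw [h1, norm_smul, Complex.norm_real, norm_inv, norm_norm, ← hn, ← mul_pow]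
    have h2 : ‖F‖⁻¹ * ‖F - rightTranslate s F‖ * ‖F‖ = ‖F - rightTranslate s F‖ := by
      field_simp
    rw [h2]
    refine (norm_pointwiseNorm_sub_sq_le J v s).trans (le_of_eq ?_)
    refine Finset.sum_congr rfl fun c _ => ?_
    rw [hv]
    dsimp only
    rw [← leftTranslate_rightTranslate, ← leftTranslate_sub, norm_leftTranslate]

/-! ### Følner sets -/

/-- A Følner set with constant 1 has a boundary no larger than itself, so adjoining the boundary at
most doubles it. The factor 2 suffices in both uses of amenability. -/
lemma exists_folner {G : Type*} [Group G] (S : Finset G)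
    (hS : Subgroup.closure (S : Set G) = ⊤)
    (hG : @IsAmenable G (wordMetricSpace S hS)) {R : ℝ} (hR : 0 < R) :
    ∃ F F' : Finset G, F.Nonempty ∧ F'.card ≤ 2 * F.card ∧
      ∀ x ∈ F, ∀ y, wordDist S x y ≤ R → y ∈ F' := by
  classical
  let _ := wordMetricSpace S hS
  obtain ⟨F, hF, hfin, hcard⟩ := hG R hR 1 one_pos
  refine ⟨F, F ∪ hfin.toFinset, hF, ?_, fun x hx y hxy => ?_⟩
  · have hpos : (0 : ℝ) < F.card := by exact_mod_cast hF.card_pos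
    rw [div_le_one hpos, Nat.cast_le, Set.ncard_eq_toFinset_card _ hfin] at hcard
    have := Finset.card_union_le F hfin.toFinset
    omega
  · rw [Finset.mem_union, Set.Finite.mem_toFinset]
    by_cases hy : y ∈ F
    · exact Or.inl hy
    · refine Or.inr ⟨by simpa using hy, ?_⟩
      refine (Metric.infDist_le_dist_of_mem (Finset.mem_coe.2 hx)).trans ?_
      rw [dist_comm]
      exact hxy

/-! ### Truncation -/

/-- The restriction of `f` to `P`, extended by zero. -/
def truncate {X : Type*} (P : Set X) (f : Ell2 X) : Ell2 X :=
  ⟨P.indicator f, by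
    refine memℓp_two_of_summable ((hasSum_normSq f).summable.of_nonneg_of_le
      (fun _ => by positivity) fun x => ?_)
    gcongr
    exact norm_indicator_le_norm_self _ _⟩

lemma truncate_apply {X : Type*} (P : Set X) (f : Ell2 X) (x : X) :
    truncate P f x = P.indicator f x := rfl

lemma summable_norm_of_memℓp_one {X : Type*} {f : X → ℂ} (hf : Memℓp f 1) : Summable fun x => ‖f x‖ := by
  simpa using hf.summable (by norm_num)

/-- Where `‖f x‖ < δ`, one has `‖f x‖ ^ 2 ≤ δ * ‖f x‖`; elsewhere the difference vanishes. -/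
lemma norm_sub_truncate_sq_le {X : Type*} {f : Ell2 X} (hf : Memℓp (fun x => f x) 1) {δ : ℝ}
    (hδ : 0 ≤ δ) :
    ‖f - truncate {x | δ ≤ ‖f x‖} f‖ ^ 2 ≤ δ * ∑' x, ‖f x‖ := by
  refine hasSum_le (fun x => ?_) (hasSum_normSq _) ((summable_norm_of_memℓp_one hf).hasSum.mul_left δ)
  rw [lp.coeFn_sub, Pi.sub_apply, truncate_apply]
  by_cases hx : δ ≤ ‖f x‖
  · rw [Set.indicator_of_mem (by exact hx)]
    simp only [sub_self, norm_zero]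
    rw [zero_pow two_ne_zero]
    positivity
  · rw [Set.indicator_of_notMem (by exact hx), sub_zero, sq]
    exact mul_le_mul_of_nonneg_right (not_le.1 hx).le (norm_nonneg _)

/-- Markov's inequality: `⌈M / δ⌉₊ + 1` such points would have total mass greater than `M`. -/
lemma encard_norm_ge_le {X : Type*} {u : X → ℂ} (hu : Summable fun x => ‖u x‖) {δ M : ℝ}
    (hδ : 0 < δ) (hM : ∑' x, ‖u x‖ ≤ M) :
    {x | δ ≤ ‖u x‖}.encard ≤ (⌈M / δ⌉₊ : ℕ∞) := by
  by_contra! h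
  obtain ⟨t, ht, hc⟩ := Set.exists_subset_encard_eq (Order.add_one_le_of_lt h)
  have hfin : t.Finite := Set.finite_of_encard_eq_coe (k := ⌈M / δ⌉₊ + 1) (by simpa using hc)
  have h1 : (hfin.toFinset.card : ℝ) * δ ≤ M := by
    rw [← nsmul_eq_mul]
    refine (Finset.card_nsmul_le_sum hfin.toFinset (fun x => ‖u x‖) δ fun x hx => ?_).trans
      ((hu.sum_le_tsum _ fun _ _ => norm_nonneg _).trans hM)
    exact ht (hfin.mem_toFinset.1 hx)
  have h2 : hfin.toFinset.card = ⌈M / δ⌉₊ + 1 := by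
    rw [hfin.encard_eq_coe_toFinset_card] at hc
    exact_mod_cast hc
  rw [h2] at h1
  have h3 := Nat.le_ceil (M / δ)
  rw [div_le_iff₀ hδ] at h3
  push_cast at h1
  linarith

lemma BoundedEll1Norm.boundedSupportCard {I : Type*} {G : I → Type*} [∀ i, Group (G i)]
    {S : ∀ i, Finset (G i)} (h : BoundedEll1Norm S) : BoundedSupportCard S := by
  intro ε hε
  obtain ⟨M, hM, f, hf⟩ := h (ε / 4) (by positivity)
  -- The truncation `w` satisfies `‖w‖ ≥ 1 - η ≥ 1/2` and has variation at most `ε/4 + 2η ≤ ε/2`, so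
  -- normalising it gives variation at most `ε`.
  set η := min (1 / 2) (ε / 8) with hη
  have hη0 : 0 < η := by positivity
  set δ := η ^ 2 / M with hδ
  have hδ0 : 0 < δ := by positivity
  suffices H : ∀ i, ∃ g ∈ Ell2UnitPos (G i), (∀ s ∈ S i, ‖g - rightTranslate s g‖ ≤ ε) ∧
      (Function.support fun γ => g γ).encard ≤ ((⌈M / δ⌉₊ + 1 : ℕ) : ℕ∞) by
    choose g hg using H
    exact ⟨_, Nat.succ_pos _, g, hg⟩
  intro i
  obtain ⟨hfi, h1, hs, hn⟩ := hf i
  set w := truncate {x | δ ≤ ‖f i x‖} (f i) with hw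
  have hfw : ‖f i - w‖ ≤ η := by
    refine le_of_sq_le_sq ((norm_sub_truncate_sq_le h1 hδ0.le).trans ?_) hη0.le
    calc δ * ∑' x, ‖f i x‖ ≤ δ * M := by gcongr
      _ = η ^ 2 := by rw [hδ]; field_simp
  have hw1 : 1 / 2 ≤ ‖w‖ := by
    have := norm_sub_norm_le (f i) w
    rw [hfi.1] at this
    linarith [min_le_left (1 / 2) (ε / 8)]
  -- With the single index 1 nothing is moved and averaging is just normalisation.
  obtain ⟨g, hg, hsupp, hgs⟩ := exists_unitPos_average {1} (fun _ => w)
    (by rw [Finset.sum_singleton]; positivity)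
  simp only [Finset.sum_singleton] at hgs
  refine ⟨g, hg, fun s hsS => ?_, ?_⟩
  · have h2 : ‖w - rightTranslate s w‖ ≤ ε / 2 := by
      have e : w - rightTranslate s w = (f i - rightTranslate s (f i)) -
          ((f i - w) - rightTranslate s (f i - w)) := by
        rw [rightTranslate_sub]; abel
      have h3 := norm_sub_le (f i - rightTranslate s (f i))
          ((f i - w) - rightTranslate s (f i - w))
      have h4 := norm_sub_le (f i - w) (rightTranslate s (f i - w))
      rw [norm_rightTranslate] at h4
      rw [e]
      linarith [hs s hsS, min_le_right (1 / 2) (ε / 8)]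
    have h5 : ‖g - rightTranslate s g‖ * ‖w‖ ≤ ‖w - rightTranslate s w‖ := by
      have := hgs s
      rw [← mul_pow] at this
      exact le_of_sq_le_sq this (norm_nonneg _)
    nlinarith [norm_nonneg (g - rightTranslate s g)]
  · refine le_trans (Set.encard_le_encard fun k hk => ?_)
      ((encard_norm_ge_le (summable_norm_of_memℓp_one h1) hδ0 hn).trans (by exact_mod_cast Nat.le_succ _))
    obtain ⟨c, hc, hne⟩ := hsupp k hk
    rw [Finset.mem_singleton] at hc
    rw [hc, one_mul, hw, truncate_apply] at hne
    exact Set.mem_of_indicator_ne_zero hne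

lemma BoundedSupportCard.boundedEll1Norm {I : Type*} {G : I → Type*} [∀ i, Group (G i)]
    {S : ∀ i, Finset (G i)} (h : BoundedSupportCard S) : BoundedEll1Norm S := by
  intro ε hε
  obtain ⟨N, hN, f, hf⟩ := h ε hε
  refine ⟨N, by exact_mod_cast hN, f, fun i => ?_⟩
  obtain ⟨hfi, hs, hc⟩ := hf i
  have hfin : (Function.support fun γ => f i γ).Finite :=
    Set.finite_of_encard_le_coe hc
  have hz : ∀ x ∉ hfin.toFinset, ‖f i x‖ = 0 := fun x hx => by
    simpa using hx
  refine ⟨hfi, memℓp_gen (by simpa using summable_of_ne_finset_zero hz), hs, ?_⟩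
  rw [tsum_eq_sum hz]
  refine (Finset.sum_le_card_nsmul _ _ 1 fun x _ => norm_le_one_of_unitPos hfi x).trans ?_
  rw [hfin.encard_eq_coe_toFinset_card] at hc
  simpa using hc

/-! ### Uniform amenability -/

/-- In the graph on a finite set `A` in which two elements are adjacent when they differ by right
multiplication by an element of `S`, one can choose a representative of each connected component,
and elements are at distance at most `#A` from the representative. -/
lemma exists_component_representative {G : Type*} [Group G] {S : Finset G}
    (hS : Subgroup.closure (S : Set G) = ⊤) (A : Finset G) :
    ∃ ρ : G → G, (∀ a ∈ A, ∀ s ∈ S, a * s ∈ A → ρ (a * s) = ρ a) ∧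
      ∀ a ∈ A, wordLength S ((ρ a)⁻¹ * a) ≤ A.card := by
  classical
  let Γ : SimpleGraph A := SimpleGraph.fromRel fun a b => ∃ s ∈ S, (b : G) = a * s
  have hadj : ∀ a b : A, Γ.Adj a b → wordLength S ((a : G)⁻¹ * b) ≤ 1 := by
    intro a b hab
    obtain ⟨-, ⟨s, hs, h⟩ | ⟨s, hs, h⟩⟩ := (SimpleGraph.fromRel_adj _ _ _).1 hab
    · rw [h, inv_mul_cancel_left]
      simpa using wordLength_le S [s] (by simp [hs])
    · rw [h, mul_inv_rev, inv_mul_cancel_right]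
      simpa using wordLength_le S [s⁻¹] (by simp [hs])
  have hwalk : ∀ (a b : A) (p : Γ.Walk a b), wordLength S ((a : G)⁻¹ * b) ≤ p.length := by
    intro a b p
    induction p with
    | nil => simp [wordLength_one]
    | @cons u v w huv p ih =>
      have := wordLength_mul_le hS ((u : G)⁻¹ * v) ((v : G)⁻¹ * w)
      rw [mul_assoc, mul_inv_cancel_left] at this
      rw [SimpleGraph.Walk.length_cons]
      have := hadj u v huv
      omega
  let r : A → A := fun a => (Γ.connectedComponentMk a).out
  refine ⟨fun a => if h : a ∈ A then (r ⟨a, h⟩ : G) else 1, fun a ha s hs has => ?_,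
    fun a ha => ?_⟩
  · dsimp only
    rw [dif_pos ha, dif_pos has]
    have : Γ.connectedComponentMk ⟨a * s, has⟩ = Γ.connectedComponentMk ⟨a, ha⟩ := by
      -- A generator equal to 1 gives no edge, since the graph has no loops.
      by_cases hne : (⟨a * s, has⟩ : A) = ⟨a, ha⟩
      · rw [hne]
      · exact SimpleGraph.ConnectedComponent.sound (SimpleGraph.Adj.reachable
          ((SimpleGraph.fromRel_adj _ _ _).2 ⟨hne, Or.inr ⟨s, hs, rfl⟩⟩))
    simp only [r, this]
  · dsimp only
    rw [dif_pos ha]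
    have : Γ.Reachable (r ⟨a, ha⟩) ⟨a, ha⟩ :=
      SimpleGraph.ConnectedComponent.exact (Quot.out_eq _)
    -- A path repeats no vertex, so its length is less than `#A`.
    obtain ⟨p, hp⟩ := this.exists_isPath
    have h1 := hp.length_lt
    rw [Fintype.card_coe] at h1
    exact (hwalk _ _ p).trans h1.le

/-- The support may be scattered, but each component has diameter controlled by its size, and right
multiplication by a generator never joins two components. Each can therefore be moved to the
identity separately, with `D = N`. -/
lemma BoundedSupportCard.uniformlyAmenable {I : Type*} {G : I → Type*} [∀ i, Group (G i)]
    {S : ∀ i, Finset (G i)} (hS : ∀ i, Subgroup.closure (S i : Set (G i)) = ⊤)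
    (h : BoundedSupportCard S) : UniformlyAmenable S := by
  classical
  intro ε hε
  obtain ⟨N, hN, f, hf⟩ := h ε hε
  suffices H : ∀ i, ∃ g ∈ Ell2UnitPos (G i), (∀ s ∈ S i, ‖g - rightTranslate s g‖ ≤ ε) ∧
      (Function.support fun γ => g γ) ⊆ {γ | wordDist (S i) 1 γ ≤ N} by
    choose g hg using H
    exact ⟨N, by exact_mod_cast hN, g, hg⟩
  intro i
  obtain ⟨hfi, hs, hc⟩ := hf i
  have hfin : (Function.support fun γ => f i γ).Finite := Set.finite_of_encard_le_coe hc
  rw [hfin.encard_eq_coe_toFinset_card] at hc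
  set A := hfin.toFinset with hA
  have hmem : ∀ x, x ∈ A ↔ f i x ≠ 0 := fun x => by simp [hA]
  obtain ⟨ρ, hρ, hlen⟩ := exists_component_representative (hS i) A
  set J := A.image ρ with hJ
  set w : G i → Ell2 (G i) := fun c => truncate {x | ρ x = c} (f i) with hw
  have hwa : ∀ c x, w c x = if ρ x = c then f i x else 0 := fun c x => by
    rw [hw, truncate_apply, Set.indicator_apply]; rfl
  have hsum : ∑ c ∈ J, ‖w c‖ ^ 2 = 1 := by
    refine (hasSum_sum fun c (_ : c ∈ J) => hasSum_normSq (w c)).unique ?_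
    have h1 := hasSum_normSq (f i)
    rw [hfi.1, one_pow] at h1
    refine h1.congr_fun fun x => ?_
    by_cases hx : x ∈ A
    · rw [Finset.sum_eq_single_of_mem (ρ x) (Finset.mem_image_of_mem ρ hx), hwa, if_pos rfl]
      intro c _ hcx
      rw [hwa, if_neg hcx.symm]; simp
    · rw [hmem, not_not] at hx
      simp [hwa, hx]
  obtain ⟨g, hg, hsupp, hgs⟩ := exists_unitPos_average J w (by rw [hsum]; exact one_pos)
  refine ⟨g, hg, fun s hsS => ?_, fun k hk => ?_⟩
  · have h1 := hgs s
    rw [hsum, mul_one] at h1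
    refine le_of_sq_le_sq (h1.trans ?_) hε.le
    refine le_trans ?_ (pow_le_pow_left₀ (norm_nonneg _) (hs s hsS) 2)
    refine hasSum_le (fun x => ?_) (hasSum_sum fun c (_ : c ∈ J) =>
      hasSum_normSq (w c - rightTranslate s (w c))) (hasSum_normSq _)
    simp only [lp.coeFn_sub, Pi.sub_apply, rightTranslate_apply, hwa]
    -- Only one index `y` contributes to the variation at `x`: if `x` and `x * s` both lie in the
    -- support they have the same representative, and otherwise at most one of the two values is
    -- nonzero.
    have key : ∀ y, (∀ c ∈ J, c ≠ y → (if ρ x = c then f i x else 0) =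
        (if ρ (x * s) = c then f i (x * s) else 0)) →
        ∑ c ∈ J, ‖(if ρ x = c then f i x else 0) -
        (if ρ (x * s) = c then f i (x * s) else 0)‖ ^ 2 ≤
        ‖(if ρ x = y then f i x else 0) - (if ρ (x * s) = y then f i (x * s) else 0)‖ ^ 2 := by
      intro y hy
      by_cases hyJ : y ∈ J
      · rw [Finset.sum_eq_single_of_mem y hyJ]
        intro c hc hcy
        rw [hy c hc hcy]; simp
      · rw [Finset.sum_eq_zero]
        · positivity
        · intro c hc
          rw [hy c hc (fun h => hyJ (h ▸ hc))]; simp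
    by_cases hx : f i x = 0
    · refine (key (ρ (x * s)) fun c _ hcy => ?_).trans ?_
      · rw [if_neg hcy.symm, hx, ite_self]
      · rw [if_pos rfl, hx, ite_self]
    · by_cases hxs : f i (x * s) = 0
      · refine (key (ρ x) fun c _ hcy => ?_).trans ?_
        · rw [if_neg hcy.symm, hxs, ite_self]
        · rw [if_pos rfl, hxs, ite_self]
      · have := hρ x ((hmem _).2 hx) s hsS ((hmem _).2 hxs)
        refine (key (ρ x) fun c _ hcy => ?_).trans ?_
        · rw [this, if_neg hcy.symm, if_neg hcy.symm]
        · rw [this, if_pos rfl, if_pos rfl]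
  · obtain ⟨c, hcJ, hne⟩ := hsupp k hk
    rw [hwa] at hne
    have h1 : ρ (c * k) = c := by
      by_contra h
      exact hne (if_neg h)
    rw [if_pos h1, ← hmem] at hne
    have h2 := hlen _ hne
    rw [h1, inv_mul_cancel_left] at h2
    simp only [Set.mem_ofPred_eq, wordDist, inv_one, one_mul, Nat.cast_le]
    exact h2.trans (by exact_mod_cast hc)

lemma encard_wordLength_le_le {G : Type*} [Group G] {S : Finset G}
    (hS : Subgroup.closure (S : Set G) = ⊤) {L : ℕ} (hL : S.card ≤ L) (n : ℕ) :
    {g | wordLength S g ≤ n}.encard ≤ (((2 * L + 1) ^ n : ℕ) : ℕ∞) := by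
  classical
  induction n with
  | zero =>
    have : {g | wordLength S g ≤ 0} ⊆ {1} := fun g hg =>
      eq_one_of_wordLength hS (Nat.le_zero.1 hg)
    simpa using Set.encard_le_encard this
  | succ n ih =>
    -- A ball of radius `n + 1` lies in `U` times the ball of radius `n`; the element 1 takes care
    -- of the empty word.
    set U : Finset G := insert 1 (S ∪ S.image (·⁻¹)) with hU
    have hUc : U.card ≤ 2 * L + 1 := by
      have h1 := Finset.card_insert_le (1 : G) (S ∪ S.image (·⁻¹))
      have h2 := Finset.card_union_le S (S.image (·⁻¹))
      have h3 := Finset.card_image_le (s := S) (f := (·⁻¹))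
      rw [← hU] at h1
      omega
    have hfin : {g | wordLength S g ≤ n}.Finite := Set.finite_of_encard_le_coe ih
    set B := hfin.toFinset with hB
    rw [hfin.encard_eq_coe_toFinset_card] at ih
    have hsub : {g | wordLength S g ≤ n + 1} ⊆
        (((U ×ˢ B).image fun p => p.1 * p.2 : Finset G) : Set G) := by
      intro g hg
      obtain ⟨l, hl, hlen, hp⟩ := exists_word hS g
      rw [Finset.mem_coe, Finset.mem_image]
      cases l with
      | nil =>
        refine ⟨(1, 1), ?_, by simpa using hp⟩
        simp [hU, hB, wordLength_one]
      | cons a l =>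
        refine ⟨(a, l.prod), ?_, by simpa using hp⟩
        rw [Finset.mem_product]
        refine ⟨?_, ?_⟩
        · rcases hl a (by simp) with h | h
          · simp [hU, h]
          · exact Finset.mem_insert_of_mem (Finset.mem_union_right _
              (Finset.mem_image.2 ⟨a⁻¹, h, inv_inv a⟩))
        · rw [hB, Set.Finite.mem_toFinset]
          have h1 := wordLength_le S l fun x hx => hl x (by simp [hx])
          have h2 : wordLength S g ≤ n + 1 := hg
          rw [List.length_cons] at hlen
          exact (by omega : wordLength S l.prod ≤ n)
    refine (Set.encard_le_encard hsub).trans ?_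
    rw [Set.encard_coe_eq_coe_finsetCard, Nat.cast_le, pow_succ']
    refine Finset.card_image_le.trans ?_
    rw [Finset.card_product]
    exact Nat.mul_le_mul hUc (by exact_mod_cast ih)

lemma UniformlyAmenable.boundedSupportCard {I : Type*} {G : I → Type*} [∀ i, Group (G i)]
    {S : ∀ i, Finset (G i)} (hS : ∀ i, Subgroup.closure (S i : Set (G i)) = ⊤)
    {L : ℕ} (hL : ∀ i, (S i).card ≤ L) (h : UniformlyAmenable S) : BoundedSupportCard S := by
  intro ε hε
  obtain ⟨D, hD, f, hf⟩ := h ε hε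
  refine ⟨(2 * L + 1) ^ ⌊D⌋₊, by positivity, f, fun i => ⟨(hf i).1, (hf i).2.1, ?_⟩⟩
  refine (Set.encard_le_encard fun g hg => ?_).trans (encard_wordLength_le_le (hS i) (hL i) ⌊D⌋₊)
  have := (hf i).2.2 hg
  simp only [Set.mem_ofPred_eq, wordDist, inv_one, one_mul] at this
  exact Nat.le_floor this

/-! ### Property A -/

/-- Telescoping along the word, since right translations are isometries. An inverse letter costs the
same as the letter itself. -/
lemma norm_sub_rightTranslate_le {G : Type*} [Group G] {S : Finset G} {f : Ell2 G} {ε : ℝ}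
    (hf : ∀ s ∈ S, ‖f - rightTranslate s f‖ ≤ ε) (l : List G)
    (hl : ∀ x ∈ l, x ∈ S ∨ x⁻¹ ∈ S) : ‖f - rightTranslate l.prod f‖ ≤ l.length * ε := by
  have comp : ∀ a b : G, rightTranslate (a * b) f = rightTranslate a (rightTranslate b f) := by
    intro a b
    ext h
    simp only [rightTranslate_apply, mul_assoc]
  have one : rightTranslate 1 f = f := by
    ext h
    simp only [rightTranslate_apply, mul_one]
  induction l with
  | nil => simp [one]
  | cons a l ih =>
    have ha : ‖f - rightTranslate a f‖ ≤ ε := by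
      rcases hl a (by simp) with h | h
      · exact hf a h
      · rw [← norm_rightTranslate a⁻¹, rightTranslate_sub, ← comp, inv_mul_cancel, one,
          norm_sub_rev]
        exact hf _ h
    have ih' := ih fun x hx => hl x (by simp [hx])
    rw [← norm_rightTranslate a, rightTranslate_sub] at ih'
    rw [List.prod_cons, List.length_cons, comp]
    have := norm_sub_le_norm_sub_add_norm_sub f (rightTranslate a f)
      (rightTranslate a (rightTranslate l.prod f))
    push_cast
    linarith

lemma UniformlyAmenable.uniformPropertyA {I : Type*} {G : I → Type*} [∀ i, Group (G i)]
    {S : ∀ i, Finset (G i)} (hS : ∀ i, Subgroup.closure (S i : Set (G i)) = ⊤)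
    (h : UniformlyAmenable S) :
    @UniformPropertyA I G (fun i => wordMetricSpace (S i) (hS i)) := by
  intro ε hε R hR
  -- Points at distance at most `R` are joined by a word of at most `R` letters, each costing `ε /
  -- R`.
  obtain ⟨D, hD, f, hf⟩ := h (ε / R) (by positivity)
  refine ⟨D, hD, fun i x => compPerm ((Equiv.inv (G i)).trans (Equiv.mulRight x)) (f i),
    fun i => ⟨fun x => ⟨?_, fun y => (hf i).1.2 _⟩, fun x y hxy => ?_, fun x y hy => ?_⟩⟩
  · rw [norm_compPerm, (hf i).1.1]
  · obtain ⟨l, hl, hlen, hp⟩ := exists_word (hS i) (x⁻¹ * y)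
    have h1 := norm_sub_rightTranslate_le (hf i).2.1 l hl
    rw [← norm_compPerm ((Equiv.inv (G i)).trans (Equiv.mulRight x)), hlen, hp] at h1
    have h2 : compPerm ((Equiv.inv (G i)).trans (Equiv.mulRight x))
        (f i - rightTranslate (x⁻¹ * y) (f i)) =
        compPerm ((Equiv.inv (G i)).trans (Equiv.mulRight x)) (f i) -
        compPerm ((Equiv.inv (G i)).trans (Equiv.mulRight y)) (f i) := by
      ext z
      change f i (z⁻¹ * x) - f i (z⁻¹ * x * (x⁻¹ * y)) = f i (z⁻¹ * x) - f i (z⁻¹ * y)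
      rw [mul_assoc, mul_inv_cancel_left]
    rw [dist_eq_norm, ← h2]
    refine h1.trans ?_
    have h3 : (wordLength (S i) (x⁻¹ * y) : ℝ) ≤ R := hxy
    calc _ ≤ R * (ε / R) := by gcongr
      _ = ε := by field_simp
  · have h1 := (hf i).2.2 (show f i (y⁻¹ * x) ≠ 0 from hy)
    change wordDist (S i) y x ≤ D
    simpa [wordDist] using h1

lemma UniformPropertyA.uniformlyAmenable {I : Type*} {G : I → Type*} [∀ i, Group (G i)]
    {S : ∀ i, Finset (G i)} (hS : ∀ i, Subgroup.closure (S i : Set (G i)) = ⊤)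
    (hG : ∀ i, @IsAmenable (G i) (wordMetricSpace (S i) (hS i)))
    (h : @UniformPropertyA I G (fun i => wordMetricSpace (S i) (hS i))) :
    UniformlyAmenable S := by
  classical
  intro ε hε
  obtain ⟨D, hD, ξ, hξ⟩ := h (ε / 2) (by positivity) 1 one_pos
  suffices H : ∀ i, ∃ g ∈ Ell2UnitPos (G i), (∀ s ∈ S i, ‖g - rightTranslate s g‖ ≤ ε) ∧
      (Function.support fun γ => g γ) ⊆ {γ | wordDist (S i) 1 γ ≤ D} by
    choose g hg using H
    exact ⟨D, hD, g, hg⟩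
  intro i
  let _ := wordMetricSpace (S i) (hS i)
  obtain ⟨h1, h2, h3⟩ := hξ i
  -- The radius is `D` from `F` to a column index `y ∈ A`, another `D` to the support of that
  -- column, and 1 for the shift by a generator.
  obtain ⟨F, B, hF, hcard, hFB⟩ := exists_folner (S i) (hS i) (hG i)
    (R := 2 * D + 1) (by positivity)
  have hFB' : ∀ x ∈ F, ∀ y, dist x y ≤ 2 * D + 1 → y ∈ B := hFB
  set A := B.filter fun y => ∃ x ∈ F, dist x y ≤ D with hA
  have hAB : ∀ y ∈ A, ∀ x, dist x y ≤ D + 1 → x ∈ B := by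
    intro y hy x hxy
    obtain ⟨z, hz, hzy⟩ := (Finset.mem_filter.1 hy).2
    refine hFB' z hz x ?_
    have := dist_triangle z y x
    rw [dist_comm y x] at this
    linarith
  have hFA : ∀ x ∈ F, ∀ y, dist x y ≤ D → y ∈ A := fun x hx y hxy =>
    Finset.mem_filter.2 ⟨hFB' x hx y (by linarith), x, hx, hxy⟩
  have hsupp : ∀ x y, ξ i x y ≠ 0 → dist x y ≤ D := fun x y hxy => by
    rw [dist_comm]
    exact h3 x hxy
  have hfin : ∀ y ∈ A, (Function.support fun x => ξ i x y).Finite := fun y hy =>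
    B.finite_toSet.subset fun x hx => hAB y hy x (by linarith [hsupp x y hx])
  -- Column `y` of `ξ`. It is known to be finitely supported only for `y ∈ A`, hence the value 0
  -- elsewhere.
  let w : G i → Ell2 (G i) := fun y =>
    if hy : y ∈ A then ⟨fun x => ξ i x y, memℓp_two_of_finite (hfin y hy)⟩ else 0
  have hw : ∀ y ∈ A, ∀ x, w y x = ξ i x y := fun y hy x => by
    simp only [w, dif_pos hy]
  -- Every row `ξ i x` with `x ∈ F` is a unit vector supported in `A`.
  have hlow : (F.card : ℝ) ≤ ∑ y ∈ A, ‖w y‖ ^ 2 := by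
    calc (F.card : ℝ) = ∑ x ∈ F, ∑ y ∈ A, ‖ξ i x y‖ ^ 2 := by
          rw [Finset.card_eq_sum_ones, Nat.cast_sum]
          refine Finset.sum_congr rfl fun x hx => ?_
          have := hasSum_normSq (ξ i x)
          rw [(h1 x).1, one_pow] at this
          rw [Nat.cast_one]
          refine this.unique (hasSum_sum_of_ne_finset_zero fun y hy => ?_)
          by_contra hne
          exact hy (hFA x hx y (hsupp x y fun h => hne (by simp [h])))
      _ = ∑ y ∈ A, ∑ x ∈ F, ‖w y x‖ ^ 2 := by
          rw [Finset.sum_comm]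
          exact Finset.sum_congr rfl fun y hy => Finset.sum_congr rfl fun x _ => by rw [hw y hy]
      _ ≤ _ := Finset.sum_le_sum fun y _ =>
          sum_le_hasSum _ (fun _ _ => by positivity) (hasSum_normSq (w y))
  have hFpos : (0 : ℝ) < F.card := by exact_mod_cast hF.card_pos
  obtain ⟨g, hg, hgsupp, hgs⟩ := exists_unitPos_average A w (hFpos.trans_le hlow)
  refine ⟨g, hg, fun s hsS => ?_, fun k hk => ?_⟩
  · have hd : ∀ x : G i, dist x (x * s) ≤ 1 := fun x => by
      change wordDist (S i) x (x * s) ≤ 1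
      rw [wordDist, inv_mul_cancel_left]
      have := wordLength_le (S i) [s] (by simp [hsS])
      rw [List.prod_singleton, List.length_singleton] at this
      exact_mod_cast this
    have hup : ∑ y ∈ A, ‖w y - rightTranslate s (w y)‖ ^ 2 ≤ B.card * (ε / 2) ^ 2 := by
      calc _ = ∑ y ∈ A, ∑ x ∈ B, ‖ξ i x y - ξ i (x * s) y‖ ^ 2 := by
            refine Finset.sum_congr rfl fun y hy => ?_
            have hval : ∀ x, (w y - rightTranslate s (w y)) x = ξ i x y - ξ i (x * s) y :=
              fun x => by
                rw [lp.coeFn_sub, Pi.sub_apply, rightTranslate_apply, hw y hy, hw y hy]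
            simp only [← hval]
            refine (hasSum_normSq _).unique (hasSum_sum_of_ne_finset_zero fun x hx => ?_)
            have z1 : ξ i x y = 0 := by
              by_contra hne
              exact hx (hAB y hy x (by linarith [hsupp x y hne]))
            have z2 : ξ i (x * s) y = 0 := by
              by_contra hne
              refine hx (hAB y hy x ?_)
              linarith [hsupp _ y hne, dist_triangle x (x * s) y, hd x]
            rw [hval, z1, z2]; simp
        _ = ∑ x ∈ B, ∑ y ∈ A, ‖(ξ i x - ξ i (x * s)) y‖ ^ 2 := Finset.sum_comm
        _ ≤ ∑ x ∈ B, (ε / 2) ^ 2 := by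
            refine Finset.sum_le_sum fun x _ => ?_
            refine (sum_le_hasSum _ (fun _ _ => by positivity) (hasSum_normSq _)).trans ?_
            refine pow_le_pow_left₀ (norm_nonneg _) ?_ 2
            rw [← dist_eq_norm]
            exact h2 x (x * s) (hd x)
        _ = _ := by rw [Finset.sum_const, nsmul_eq_mul]
    refine le_of_sq_le_sq ?_ hε.le
    have hB : (B.card : ℝ) ≤ 2 * F.card := by exact_mod_cast hcard
    have := (hgs s).trans hup
    -- The factor 2 from `#B ≤ 2 #F` is absorbed by having started with `ε / 2`.
    have h4 : ‖g - rightTranslate s g‖ ^ 2 * F.card ≤ 2 * F.card * (ε / 2) ^ 2 :=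
      (mul_le_mul_of_nonneg_left hlow (by positivity)).trans (this.trans (by gcongr))
    have h5 : ‖g - rightTranslate s g‖ ^ 2 ≤ 2 * (ε / 2) ^ 2 := by
      refine le_of_mul_le_mul_right ?_ hFpos
      linarith
    nlinarith
  · obtain ⟨c, hc, hne⟩ := hgsupp k hk
    rw [hw c hc] at hne
    have := hsupp _ _ hne
    rw [dist_comm] at this
    have h4 : wordDist (S i) c (c * k) ≤ D := this
    simpa [wordDist] using h4

/-! ### The operator associated to a function -/

/-- The convolution operator `∑ w, f w • ρ(w⁻¹)` of a function `f`, where `ρ` denotes right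
translation. -/
def convolution {G : Type*} [Group G] (f : G → ℂ) : Ell2 G →L[ℂ] Ell2 G :=
  ∑' w, f w • (compPermₗᵢ (Equiv.mulRight w⁻¹)).toContinuousLinearMap

lemma norm_smul_compPerm_le {G : Type*} [Group G] (f : G → ℂ) (w : G) :
    ‖f w • (compPermₗᵢ (Equiv.mulRight w⁻¹) : Ell2 G →ₗᵢ[ℂ] Ell2 G).toContinuousLinearMap‖ ≤
      ‖f w‖ := by
  rw [norm_smul]
  exact mul_le_of_le_one_right (norm_nonneg _) (LinearIsometry.norm_toContinuousLinearMap_le _)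

lemma norm_convolution_le {G : Type*} [Group G] {f : G → ℂ} (hf : Summable fun x => ‖f x‖) :
    ‖convolution f‖ ≤ ∑' x, ‖f x‖ :=
  tsum_of_norm_bounded hf.hasSum (norm_smul_compPerm_le f)

lemma convolution_apply {G : Type*} [Group G] {f : G → ℂ} (hf : Summable fun x => ‖f x‖)
    (h : Ell2 G) (z : G) : HasSum (fun w => f w * h (z * w⁻¹)) (convolution f h z) := by
  have h1 : HasSum (fun w => f w •
      (compPermₗᵢ (Equiv.mulRight w⁻¹) : Ell2 G →ₗᵢ[ℂ] Ell2 G).toContinuousLinearMap)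
      (convolution f) :=
    (Summable.of_norm_bounded hf (norm_smul_compPerm_le f)).hasSum
  have h2 := h1.mapL (ContinuousLinearMap.apply ℂ (Ell2 G) h)
  exact h2.mapL (lp.evalCLM ℂ (fun _ : G => ℂ) 2 z)

lemma convolution_single {G : Type*} [Group G] [DecidableEq G] (f : Ell2 G)
    (hf : Memℓp (fun x => f x) 1) (γ : G) :
    convolution f (lp.single 2 γ 1) = leftTranslate γ f := by
  ext z
  refine (convolution_apply (summable_norm_of_memℓp_one hf) _ z).unique ?_
  have h1 : (fun w => f w * lp.single (E := fun _ : G => ℂ) 2 γ 1 (z * w⁻¹)) =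
      fun w => if w = γ⁻¹ * z then f (γ⁻¹ * z) else 0 := by
    ext w
    rw [lp.single_apply, Pi.single_apply]
    by_cases hw : w = γ⁻¹ * z
    · simp [hw]
    · rw [if_neg hw, if_neg, mul_zero]
      intro h
      apply hw
      rw [← h]
      group
  rw [h1, leftTranslate_apply]
  exact hasSum_ite_eq _ _

lemma eq_sum_single {X : Type*} [DecidableEq X] (h : X →₀ ℂ) (α : Ell2 X) (hα : ∀ x, α x = h x) :
    α = ∑ x ∈ h.support, h x • lp.single (E := fun _ : X => ℂ) 2 x 1 := by
  ext y
  rw [lp.coeFn_sum, Finset.sum_apply, hα]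
  simp only [lp.coeFn_smul, Pi.smul_apply, lp.single_apply, Pi.single_apply, smul_eq_mul, mul_ite,
    mul_one, mul_zero]
  rw [Finset.sum_ite_eq]
  split_ifs with hy
  · rfl
  · simpa using hy

/-- Since `f` is real-valued, its Gram kernel is symmetric and not merely Hermitian. -/
lemma assocKernel_comm {G : Type*} [Group G] {f : Ell2 G} (hf : ∀ x, 0 ≤ f x) (x y : G) :
    assocKernel f x y = assocKernel f y x := by
  have hreal : ∀ x, (starRingEnd ℂ) (f x) = f x := fun x => by
    rw [Complex.conj_eq_iff_im]
    exact (Complex.nonneg_iff.1 (hf x)).2.symm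
  rw [assocKernel, assocKernel, lp.inner_eq_tsum, lp.inner_eq_tsum]
  refine tsum_congr fun z => ?_
  simp only [leftTranslate_apply, RCLike.inner_apply, hreal]
  ring

/-- The kernel is the Gram matrix of the translates `γ ⋆ f`, which are the columns of `convolution
f`; hence the operator is `C* C` with `C = convolution f`. -/
lemma exists_isAssocOperator {G : Type*} [Group G] {f : Ell2 G} (hf : ∀ x, 0 ≤ f x)
    (h1 : Memℓp (fun x => f x) 1) :
    ∃ T : Ell2 G →L[ℂ] Ell2 G, IsAssocOperator f T ∧ ‖T‖ ≤ (∑' x, ‖f x‖) ^ 2 := by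
  classical
  refine ⟨(convolution f).adjoint ∘L convolution f, fun h α hα γ => ?_, ?_⟩
  · have e1 : ((convolution f).adjoint ∘L convolution f) α γ =
        inner ℂ (lp.single (E := fun _ : G => ℂ) 2 γ 1)
          ((convolution f).adjoint (convolution f α)) := by
      rw [lp.inner_single_left]
      simp
    rw [e1, ContinuousLinearMap.adjoint_inner_right, convolution_single f h1,
      eq_sum_single h α hα, map_sum, inner_sum]
    refine Finset.sum_congr rfl fun γ' _ => ?_
    rw [map_smul, convolution_single f h1, inner_smul_right, assocKernel_comm hf, mul_comm]
    rfl
  · calc ‖(convolution f).adjoint ∘L convolution f‖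
        ≤ ‖(convolution f).adjoint‖ * ‖convolution f‖ := ContinuousLinearMap.opNorm_comp_le _ _
      _ = ‖convolution f‖ ^ 2 := by rw [LinearIsometryEquiv.norm_map, sq]
      _ ≤ _ := pow_le_pow_left₀ (norm_nonneg _) (norm_convolution_le (summable_norm_of_memℓp_one h1)) 2

/-- The quadratic form of the associated operator at the indicator function of `B`. -/
lemma norm_sum_leftTranslate_sq_le {G : Type*} [Group G] {f : Ell2 G} {T : Ell2 G →L[ℂ] Ell2 G}
    (hf : ∀ x, 0 ≤ f x) (hT : IsAssocOperator f T) (B : Finset G) :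
    ‖∑ γ ∈ B, leftTranslate γ f‖ ^ 2 ≤ ‖T‖ * B.card := by
  classical
  set α : Ell2 G := ∑ γ ∈ B, lp.single (E := fun _ : G => ℂ) 2 γ 1 with hα
  have hαx : ∀ x, α x = if x ∈ B then 1 else 0 := fun x => by
    rw [hα, lp.coeFn_sum, Finset.sum_apply]
    simp only [lp.single_apply, Pi.single_apply]
    rw [Finset.sum_ite_eq]
  have hαn : ‖α‖ ^ 2 = B.card := by
    have h := lp.norm_sum_single (E := fun _ : G => ℂ) (p := 2) (by norm_num) (fun _ => 1) B
    simpa using h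
  let h : G →₀ ℂ := Finsupp.indicator B fun _ _ => 1
  have hh : ∀ x, α x = h x := fun x => by
    rw [hαx, Finsupp.indicator_apply]
    simp
  have hTα : ∀ γ, T α γ = ∑ γ' ∈ B, assocKernel f γ γ' := fun γ => by
    rw [hT h α hh γ, kernelApply]
    rw [Finset.sum_subset (Finsupp.support_indicator_subset B _)]
    · refine Finset.sum_congr rfl fun x hx => ?_
      rw [← hh, hαx, if_pos hx, mul_one]
    · intro x _ hx
      rw [Finsupp.notMem_support_iff.1 hx, mul_zero]
  -- Both sides are the sum of the Gram kernel over `B × B`.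
  have key : inner ℂ α (T α) = inner ℂ (∑ γ ∈ B, leftTranslate γ f) (∑ γ ∈ B, leftTranslate γ f) := by
    rw [sum_inner]
    nth_rewrite 1 [hα]
    rw [sum_inner]
    refine Finset.sum_congr rfl fun γ _ => ?_
    rw [lp.inner_single_left, hTα, RCLike.inner_apply, map_one, mul_one, inner_sum]
    exact Finset.sum_congr rfl fun γ' _ => assocKernel_comm hf _ _
  rw [inner_self_eq_norm_sq_to_K] at key
  have h2 := norm_inner_le_norm (𝕜 := ℂ) α (T α)
  rw [key] at h2
  have h3 : ‖α‖ * ‖T α‖ ≤ ‖T‖ * B.card := by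
    rw [← hαn]
    have := mul_le_mul_of_nonneg_left (T.le_opNorm α) (norm_nonneg α)
    nlinarith
  refine le_trans (le_of_eq ?_) (h2.trans h3)
  simp

/-- Let `B` contain `F E⁻¹` with `#B ≤ 2 #F`. At each `z ∈ F` the function `g = ∑ γ ∈ B, γ ⋆ f` is
at least the sum of `f` over `E`, by positivity and the terms `γ = z x⁻¹`. Hence `#F (∑ x ∈ E, ‖f
x‖)² ≤ ‖g‖² ≤ ‖T‖ #B ≤ 2 ‖T‖ #F`. -/
lemma sq_sum_norm_le {G : Type*} [Group G] (S : Finset G)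
    (hS : Subgroup.closure (S : Set G) = ⊤)
    (hG : @IsAmenable G (wordMetricSpace S hS)) {f : Ell2 G} (hf : f ∈ Ell2UnitPos G)
    {T : Ell2 G →L[ℂ] Ell2 G} (hT : IsAssocOperator f T) (E : Finset G) :
    (∑ x ∈ E, ‖f x‖) ^ 2 ≤ 2 * ‖T‖ := by
  classical
  -- The sum of lengths bounds the length of each `x⁻¹` with `x ∈ E`; adding 1 keeps the radius
  -- positive when the sum is zero.
  obtain ⟨F, B, hF, hcard, hFB⟩ := exists_folner S hS hG
    (R := ∑ x ∈ E, (wordLength S x⁻¹ : ℝ) + 1) (by positivity)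
  have hFpos : (0 : ℝ) < F.card := by exact_mod_cast hF.card_pos
  have hB : (B.card : ℝ) ≤ 2 * F.card := by exact_mod_cast hcard
  have hmem : ∀ z ∈ F, ∀ x ∈ E, z * x⁻¹ ∈ B := fun z hz x hx => by
    refine hFB z hz _ ?_
    rw [wordDist, inv_mul_cancel_left]
    have := Finset.single_le_sum (f := fun x => (wordLength S x⁻¹ : ℝ))
      (fun _ _ => by positivity) hx
    linarith
  set g : Ell2 G := ∑ γ ∈ B, leftTranslate γ f with hg
  have hval : ∀ z ∈ F, ∑ x ∈ E, ‖f x‖ ≤ ‖g z‖ := fun z hz => by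
    have e : g z = ((∑ γ ∈ B, ‖f (γ⁻¹ * z)‖ : ℝ) : ℂ) := by
      rw [hg, lp.coeFn_sum, Finset.sum_apply, Complex.ofReal_sum]
      exact Finset.sum_congr rfl fun γ _ => (coe_norm_of_unitPos hf _).symm
    rw [e, Complex.norm_real, Real.norm_of_nonneg (by positivity)]
    have inj : ∀ x ∈ E, ∀ y ∈ E, z * x⁻¹ = z * y⁻¹ → x = y := fun x _ y _ h => by simpa using h
    calc ∑ x ∈ E, ‖f x‖ = ∑ γ ∈ E.image fun x => z * x⁻¹, ‖f (γ⁻¹ * z)‖ := by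
          rw [Finset.sum_image inj]
          simp
      _ ≤ _ := Finset.sum_le_sum_of_subset_of_nonneg
          (Finset.image_subset_iff.2 (hmem z hz)) fun _ _ _ => norm_nonneg _
  have h1 : F.card * (∑ x ∈ E, ‖f x‖) ^ 2 ≤ ‖g‖ ^ 2 := by
    rw [← nsmul_eq_mul]
    refine (Finset.card_nsmul_le_sum F (fun z => ‖g z‖ ^ 2) _ fun z hz => ?_).trans
      (sum_le_hasSum _ (fun _ _ => by positivity) (hasSum_normSq g))
    exact pow_le_pow_left₀ (by positivity) (hval z hz) 2
  have h2 := norm_sum_leftTranslate_sq_le hf.2 hT B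
  refine le_of_mul_le_mul_left ?_ hFpos
  nlinarith [mul_le_mul_of_nonneg_left hB (norm_nonneg T)]

lemma BoundedEll1Norm.boundedOperatorNorm {I : Type*} {G : I → Type*} [∀ i, Group (G i)]
    {S : ∀ i, Finset (G i)} (h : BoundedEll1Norm S) : BoundedOperatorNorm S := by
  intro ε hε
  obtain ⟨M, hM, f, hf⟩ := h ε hε
  refine ⟨M ^ 2, by positivity, f, fun i => ?_⟩
  obtain ⟨hfi, h1, hs, hn⟩ := hf i
  obtain ⟨T, hT, hTn⟩ := exists_isAssocOperator hfi.2 h1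
  exact ⟨hfi, h1, hs, T, hT, hTn.trans
    (pow_le_pow_left₀ (tsum_nonneg fun _ => norm_nonneg _) hn 2)⟩

lemma BoundedOperatorNorm.boundedEll1Norm {I : Type*} {G : I → Type*} [∀ i, Group (G i)]
    {S : ∀ i, Finset (G i)} (hS : ∀ i, Subgroup.closure (S i : Set (G i)) = ⊤)
    (hG : ∀ i, @IsAmenable (G i) (wordMetricSpace (S i) (hS i)))
    (h : BoundedOperatorNorm S) : BoundedEll1Norm S := by
  intro ε hε
  obtain ⟨M, hM, f, hf⟩ := h ε hε
  refine ⟨√(2 * M), by positivity, f, fun i => ?_⟩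
  obtain ⟨hfi, h1, hs, T, hT, hTn⟩ := hf i
  refine ⟨hfi, h1, hs, (summable_norm_of_memℓp_one h1).tsum_le_of_sum_le fun E => Real.le_sqrt_of_sq_le ?_⟩
  exact (sq_sum_norm_le (S i) (hS i) (hG i) hfi hT E).trans (by linarith)

end UniformAmenability

end

theorem theorem3p7 {I : Type*} {G : I → Type*} [∀ i, Group (G i)]
    (S : ∀ i, Finset (G i))
    (hS : ∀ i, Subgroup.closure (S i : Set (G i)) = ⊤)
    (hG : ∀ i, @UniformAmenability.IsAmenable (G i)
      (UniformAmenability.wordMetricSpace (S i) (hS i))) :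
    ((UniformAmenability.BoundedEll1Norm S ↔ UniformAmenability.BoundedOperatorNorm S) ∧
      (UniformAmenability.BoundedOperatorNorm S → UniformAmenability.BoundedSupportCard S) ∧
      (UniformAmenability.BoundedSupportCard S → UniformAmenability.UniformlyAmenable S) ∧
      (UniformAmenability.UniformlyAmenable S ↔
        @UniformAmenability.UniformPropertyA I G
          (fun i => UniformAmenability.wordMetricSpace (S i) (hS i)))) ∧
    ((∃ L : ℕ, 0 < L ∧ ∀ i, (S i).card ≤ L) →
      List.TFAE [UniformAmenability.BoundedEll1Norm S,
        UniformAmenability.BoundedOperatorNorm S,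
        UniformAmenability.BoundedSupportCard S,
        UniformAmenability.UniformlyAmenable S,
        @UniformAmenability.UniformPropertyA I G
          (fun i => UniformAmenability.wordMetricSpace (S i) (hS i))]) := by

  open UniformAmenability in
  have h12 : BoundedEll1Norm S ↔ BoundedOperatorNorm S :=
    ⟨fun h => h.boundedOperatorNorm, fun h => h.boundedEll1Norm hS hG⟩
  have h45 : UniformlyAmenable S ↔
      @UniformPropertyA I G (fun i => wordMetricSpace (S i) (hS i)) :=
    ⟨fun h => h.uniformPropertyA hS, fun h => UniformPropertyA.uniformlyAmenable hS hG h⟩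
  have h13 : BoundedEll1Norm S ↔ BoundedSupportCard S :=
    ⟨fun h => h.boundedSupportCard, fun h => h.boundedEll1Norm⟩
  have h34 : BoundedSupportCard S → UniformlyAmenable S := fun h => h.uniformlyAmenable hS
  refine ⟨⟨h12, fun h => h13.1 (h12.2 h), h34, h45⟩, ?_⟩
  rintro ⟨L, -, hL⟩
  tfae_have 1 ↔ 2 := h12
  tfae_have 1 ↔ 3 := h13
  tfae_have 3 → 4 := h34
  tfae_have 4 → 3 := fun h => h.boundedSupportCard hS hL
  tfae_have 4 ↔ 5 := h45
  tfae_finish
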